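/- Let $0<q<1$ and let $\int_0^\infty f(x)\,d_qx=(1-q)\sum_{m\in\mathbb Z}f(q^m)q^m$ be the Jackson integral. Let $$w(x;q)=\frac{1}{(1-q)\sqrt q\,c_q}\,x^{-1/2}\,e^{(\log x)^2/(2\log q)},\qquad c_q=\prod_{l=0}^\infty(1+q^{l+1})(1+q^l)(1-q^{l+1}),$$ be the Stieltjes–Wigert weight on the $q$-lattice $\{q^m : m\in\mathbb Z\}$. For $N\ge1$ consider the ensemble of $N$ particles on this lattice with joint density proportional to $\prod_{l=1}^N w(x_l;q)\prod_{1\le j<l\le N}|x_l-x_j|^2$ with respect to $d_qx_1\cdots d_qx_N$; let $\rho_{(1),N}(x)$ be its eigenvalue density, that is, $N$ times the normalised joint density with $x_1=x$ and $x_2,\dots,x_N$ integrated out. Define the moments $$m_{k,N}=\int_0^\infty (q^{-1/2}x)^k\,\rho_{(1),N}(x)\,d_qx .$$ With $(u;q)_n=(1-u)(1-qu)\cdots(1-q^{n-1}u)$, the following holds for every integer $k\ge1$. The integrals defining the normalisation and the moments converge absolutely for every $N\ge1$, the normalisation is positive, and for all complex $z$ with $|z|<1$ $$\sum_{N=1}^\infty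 (q^{2k}z)^N\,m_{k,N}=q^{-(k^2-2k)/2}\,\frac{z}{1-z}\,\frac{(q^{k+1}z;q)_{k-1}}{(qz;q)_k},$$ the series being absolutely convergent. Equivalently, if the moments are taken in the unscaled variable, that is, if $m_{k,N}$ is replaced by $\int_0^\infty x^k\rho_{(1),N}(x)\,d_qx$, the right-hand side is multiplied by $q^{k/2}$. -/

import Mathlib

noncomputable section

/-- The `q`-Pochhammer symbol `(u;q)_n = (1 - u)(1 - q u) ⋯ (1 - q^(n-1) u)`. -/
def qPoch (u q : ℂ) (n : ℕ) : ℂ :=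
  ∏ i ∈ Finset.range n, (1 - q ^ i * u)

/-- The infinite product
`(α, β, γ; q)_∞ = ∏_{l ≥ 0} (1 - α q^l) (1 - β q^l) (1 - γ q^l)`. -/
def qPochInfThree (α β γ q : ℝ) : ℝ :=
  ∏' l : ℕ, ((1 - α * q ^ l) * (1 - β * q ^ l) * (1 - γ * q ^ l))

/-- The Jackson integral
`∫_0^∞ f(x) d_q x = (1 - q) ∑_{m ∈ ℤ} f(q^m) q^m`. -/
def jacksonIntegral (q : ℝ) (f : ℝ → ℝ) : ℝ :=
  (1 - q) * ∑' m : ℤ, f (q ^ m) * q ^ m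

/-- The summand, at the lattice point `(q^(m_1), …, q^(m_N))`, of the `N`-fold Jackson integral
of `f`. -/
def jacksonTerm (q : ℝ) {N : ℕ} (f : (Fin N → ℝ) → ℝ) (m : Fin N → ℤ) : ℝ :=
  f (fun l => q ^ m l) * ∏ l, q ^ m l

/-- Absolute convergence of the `N`-fold Jackson integral of `f` over `(0, ∞)^N`. -/
def JacksonIntegrable (q : ℝ) {N : ℕ} (f : (Fin N → ℝ) → ℝ) : Prop :=
  Summable (jacksonTerm q f)

/-- The `N`-fold Jackson integral `∫_0^∞ ⋯ ∫_0^∞ f(x_1, …, x_N) d_q x_1 ⋯ d_q x_N`,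
as a sum over the lattice of points `(q^(m_1), …, q^(m_N))`, `m ∈ ℤ^N`. -/
def multiJacksonIntegral (q : ℝ) {N : ℕ} (f : (Fin N → ℝ) → ℝ) : ℝ :=
  (1 - q) ^ N * ∑' m : Fin N → ℤ, jacksonTerm q f m

/-- The Stieltjes–Wigert weight on the `q`-lattice,
`w(x;q) = x^(-1/2) exp((log x)^2 / (2 log q)) / ((1 - q) √q c_q)`
with `c_q = (-q, -1, q; q)_∞`. -/
def jacksonSWWeight (q x : ℝ) : ℝ :=
  1 / ((1 - q) * √q * qPochInfThree (-q) (-1) q q) *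
    x ^ (-(1 / 2) : ℝ) * Real.exp ((Real.log x) ^ 2 / (2 * Real.log q))

/-- The unnormalised joint density `∏_l w(x_l) ∏_{j < k} |x_k - x_j|^2` of the ensemble with `N`
particles. -/
def jacksonSWDensity (q : ℝ) {N : ℕ} (x : Fin N → ℝ) : ℝ :=
  (∏ l, jacksonSWWeight q (x l)) * ∏ j, ∏ k ∈ Finset.Ioi j, |x k - x j| ^ 2

/-- The normalisation (partition function) of the ensemble with `N` particles. -/
def jacksonSWNorm (q : ℝ) (N : ℕ) : ℝ :=
  multiJacksonIntegral q (jacksonSWDensity q (N := N))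

/-- The eigenvalue density `ρ_{(1),N}(x)` for `N = n + 1` particles: `N` times the normalised joint
density, with all variables but the first one integrated out. -/
def jacksonSWSpectralDensity (q : ℝ) (n : ℕ) (x : ℝ) : ℝ :=
  ((n + 1 : ℕ) : ℝ) / jacksonSWNorm q (n + 1) *
    multiJacksonIntegral q (fun y : Fin n → ℝ => jacksonSWDensity q (Fin.cons x y : Fin (n + 1) → ℝ))

/-- The `k`-th moment `∫_0^∞ x^k ρ_{(1),N}(x) d_q x` of the density, `N = n + 1`, in the variable
`x` of the `q`-lattice. -/
def jacksonSWLatticeMoment (q : ℝ) (k n : ℕ) : ℝ :=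
  jacksonIntegral q (fun x => x ^ k * jacksonSWSpectralDensity q n x)

/-- The `k`-th moment `∫_0^∞ (q^(-1/2) x)^k ρ_{(1),N}(x) d_q x` of the density, `N = n + 1`, in the
variable `q^(-1/2) x`, for which the weight has the moments `q^(-(n+1)^2/2)` of the log-normal
Stieltjes–Wigert weight. -/
def jacksonSWMoment (q : ℝ) (k n : ℕ) : ℝ :=
  jacksonIntegral q (fun x => (q ^ (-(1 / 2) : ℝ) * x) ^ k * jacksonSWSpectralDensity q n x)

/-- The product `q^(-(k^2 - 2k)/2) · z/(1 - z) · (q^(k+1) z; q)_{k-1} / (q z; q)_k`. -/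
def jacksonSWGenFun (q : ℝ) (k : ℕ) (z : ℂ) : ℂ :=
  ((q ^ (-((k : ℝ) ^ 2 - 2 * (k : ℝ)) / 2) : ℝ) : ℂ) * (z / (1 - z)) *
    (qPoch ((q : ℂ) ^ (k + 1) * z) q (k - 1) / qPoch ((q : ℂ) * z) q k)

end

/-!
The mass that the weight gives to the lattice point `q^m` is a constant times `q^(m(m+1)/2)`, so a
shift of the summation index shows that its moments are `M q^(-a(a+1)/2)` for some `M > 0`
(`exists_hasSum_pow_mul_swMass`). The constant `c_q` enters only through its positivity: it cancels
in the normalised density, and the triple product identity is not needed.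

For such moments the finite `q`-binomial theorem evaluates the pairing of `x^a` with the monic
polynomial `p_n = (-1)^n q^(-n^2) ∑_j (-1)^j [n, j] q^(j^2) x^j` as a multiple of `(q^(-a); q)_n`
(`hasSum_pow_mul_swPoly`). This vanishes for `a < n`, so the `p_n` are orthogonal. Expanding the two
Vandermonde determinants of the joint density in the `p_n` leaves only diagonal terms
(`hasSum_mul_det_sq`), and the moment for `N` particles is
`∑_{n < N} ⟨x^k p_n, p_n⟩ / ⟨p_n, p_n⟩` (`jacksonSWLatticeMoment_eq_sum`).

Since `⟨x^(k+l), p_n⟩ = 0` for `k + l < n`, each summand is a sum of at most `k + 1` terms. After the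
symmetry of `q`-trinomial coefficients (`gaussBinom_mul_gaussBinom_comm`) it is, up to `q^(2kn)`, the
coefficient of `z^n` in `q^(-k(k+1)/2) (q^(k+1) z; q)_k / (z; q)_{k+1}`
(`swPolyPairing_self_div`). Summing over `n < N` multiplies the generating function by
`1 / (1 - q^(2k) z)`, which cancels the last factor of `(q^(k+1) z; q)_k`.
-/

open Finset Polynomial

/-! ### Gaussian binomial coefficients -/

/-- The Gaussian binomial coefficient `[n, k]_q`, defined by the `q`-Pascal rule
`[n+1, k+1] = [n, k] + q^(k+1) [n, k+1]`. -/
def gaussBinom {R : Type*} [CommRing R] (q : R) : ℕ → ℕ → R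
  | _, 0 => 1
  | 0, _ + 1 => 0
  | n + 1, k + 1 => gaussBinom q n k + q ^ (k + 1) * gaussBinom q n (k + 1)

section GaussBinom

variable {R : Type*} [CommRing R] (q : R)

@[simp] lemma gaussBinom_zero_right (n : ℕ) : gaussBinom q n 0 = 1 := by
  cases n <;> rfl

lemma gaussBinom_succ_succ (n k : ℕ) :
    gaussBinom q (n + 1) (k + 1) = gaussBinom q n k + q ^ (k + 1) * gaussBinom q n (k + 1) := rfl

lemma gaussBinom_eq_zero_of_lt {n k : ℕ} (h : n < k) : gaussBinom q n k = 0 := by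
  induction n generalizing k with
  | zero => obtain ⟨k, rfl⟩ := Nat.exists_eq_succ_of_ne_zero h.ne'; rfl
  | succ n ih =>
    obtain ⟨k, rfl⟩ := Nat.exists_eq_succ_of_ne_zero (Nat.ne_zero_of_lt h)
    rw [Nat.succ_eq_add_one, gaussBinom_succ_succ, ih (by omega), ih (by omega), mul_zero, add_zero]

@[simp] lemma gaussBinom_self (n : ℕ) : gaussBinom q n n = 1 := by
  induction n with
  | zero => rfl
  | succ n ih => rw [gaussBinom_succ_succ, ih, gaussBinom_eq_zero_of_lt q n.lt_succ_self]; simp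

lemma gaussBinom_ofReal (q : ℝ) (n k : ℕ) :
    gaussBinom (q : ℂ) n k = (gaussBinom q n k : ℝ) := by
  induction n generalizing k with
  | zero => cases k <;> simp [gaussBinom]
  | succ n ih => cases k <;> simp [gaussBinom, ih]

lemma pow_choose_two_succ (n : ℕ) : q ^ (n + 1).choose 2 = q ^ n.choose 2 * q ^ n := by
  rw [Nat.choose_succ_succ' n 1, Nat.choose_one_right, pow_add, mul_comm]

lemma pow_choose_two_add (a b : ℕ) :
    q ^ (a + b).choose 2 = q ^ a.choose 2 * q ^ b.choose 2 * q ^ (a * b) := by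
  induction b with
  | zero => simp
  | succ b ih => rw [← add_assoc, pow_choose_two_succ, ih, pow_choose_two_succ]; ring

lemma pow_sq_eq_pow_choose_two (j : ℕ) :
    q ^ j ^ 2 = q ^ j.choose 2 * q ^ j.choose 2 * q ^ j := by
  induction j with
  | zero => simp
  | succ j ih =>
    rw [pow_choose_two_succ, show (j + 1) ^ 2 = j ^ 2 + (j + j + 1) by ring, pow_add, ih]
    ring

/-- The finite `q`-binomial theorem. -/
lemma prod_one_sub_eq_sum_gaussBinom (n : ℕ) (x : R) :
    ∏ i ∈ range n, (1 - q ^ i * x) =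
      ∑ j ∈ range (n + 1), (-1) ^ j * q ^ j.choose 2 * gaussBinom q n j * x ^ j := by
  induction n generalizing x with
  | zero => simp
  | succ n ih =>
    have h : ∏ i ∈ range n, (1 - q ^ (i + 1) * x) = ∏ i ∈ range n, (1 - q ^ i * (q * x)) :=
      prod_congr rfl fun i _ => by ring
    have h2 : ∑ j ∈ range (n + 1), (-1) ^ j * q ^ j.choose 2 * gaussBinom q n j * (q * x) ^ j =
        ∑ j ∈ range (n + 1), (-1) ^ (j + 1) * q ^ (j + 1).choose 2 * gaussBinom q n (j + 1)
          * (q * x) ^ (j + 1) + 1 := by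
      have h3 := sum_range_succ'
        (fun j => (-1) ^ j * q ^ j.choose 2 * gaussBinom q n j * (q * x) ^ j) (n + 1)
      rw [sum_range_succ _ (n + 1), gaussBinom_eq_zero_of_lt q n.lt_succ_self] at h3
      simpa using h3
    rw [prod_range_succ', h, ih, sum_range_succ' _ (n + 1), pow_zero, one_mul, mul_sub, mul_one,
      sum_mul]
    nth_rewrite 1 [h2]
    rw [add_sub_right_comm, ← sum_sub_distrib]
    simp only [pow_zero, Nat.choose_zero_succ, gaussBinom_zero_right, mul_one]
    congr 1
    refine sum_congr rfl fun j _ => ?_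
    rw [gaussBinom_succ_succ, pow_choose_two_succ]
    ring

/-- The product `(q; q)_n = (1 - q)(1 - q^2) ⋯ (1 - q^n)`. -/
def qFact (n : ℕ) : R := ∏ i ∈ range n, (1 - q ^ (i + 1))

lemma qFact_succ (n : ℕ) : qFact q (n + 1) = qFact q n * (1 - q ^ (n + 1)) := prod_range_succ _ _

/-- The factorial formula `[a + b, a] = (q; q)_{a+b} / ((q; q)_a (q; q)_b)`. -/
lemma gaussBinom_mul_qFact_mul_qFact (a b : ℕ) :
    gaussBinom q (a + b) a * qFact q a * qFact q b = qFact q (a + b) := by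
  induction h : a + b generalizing a b with
  | zero =>
    obtain ⟨rfl, rfl⟩ := Nat.add_eq_zero_iff.1 h
    simp [qFact]
  | succ n ih =>
    rcases a with _ | a
    · obtain rfl : b = n + 1 := by omega
      simp [qFact]
    rcases b with _ | b
    · obtain rfl : a = n := by omega
      simp [qFact]
    have h1 := ih a (b + 1) (by omega)
    have h2 := ih (a + 1) b (by omega)
    obtain rfl : n = a + (b + 1) := by omega
    rw [gaussBinom_succ_succ, qFact_succ q (a + (b + 1))]
    rw [qFact_succ] at h1 h2 ⊢
    rw [qFact_succ]
    linear_combination (1 - q ^ (a + 1)) * h1 + q ^ (a + 1) * (1 - q ^ (b + 1)) * h2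

end GaussBinom

lemma qFact_pos {q : ℝ} (hq0 : 0 < q) (hq1 : q < 1) (n : ℕ) : 0 < qFact q n :=
  prod_pos fun i _ => sub_pos.2 (pow_lt_one₀ hq0.le hq1 i.succ_ne_zero)

/-- The trinomial symmetry `[n, n - i] [n + k - i, n] = [k, i] [n + k - i, k]`, with `n = i + a`
and `k = i + b`. -/
lemma gaussBinom_mul_gaussBinom_comm {q : ℝ} (hq0 : 0 < q) (hq1 : q < 1) (i a b : ℕ) :
    gaussBinom q (i + a) a * gaussBinom q (i + a + b) (i + a) =
      gaussBinom q (i + b) i * gaussBinom q (i + a + b) (i + b) := by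
  have h1 := gaussBinom_mul_qFact_mul_qFact q a i
  have h2 := gaussBinom_mul_qFact_mul_qFact q (i + a) b
  have h3 := gaussBinom_mul_qFact_mul_qFact q i b
  have h4 := gaussBinom_mul_qFact_mul_qFact q (i + b) a
  rw [add_comm a i] at h1
  rw [add_right_comm] at h4
  have hi := (qFact_pos hq0 hq1 i).ne'
  have ha := (qFact_pos hq0 hq1 a).ne'
  have hb := (qFact_pos hq0 hq1 b).ne'
  refine mul_right_cancel₀ (mul_ne_zero (mul_ne_zero hi ha) hb) ?_
  linear_combination gaussBinom q (i + a + b) (i + a) * qFact q b * h1 + h2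
    - gaussBinom q (i + a + b) (i + b) * qFact q a * h3 - h4

/-- Evaluation of `(q^(-(n+c)); q)_n`. -/
lemma prod_one_sub_div_mul_qFact {q : ℝ} (hq0 : 0 < q) (n c : ℕ) :
    (∏ i ∈ range n, (1 - q ^ i * (q ^ (n + c))⁻¹)) * qFact q c =
      (-1) ^ n * q ^ n.choose 2 * (q ^ ((n + c) * n))⁻¹ * qFact q (n + c) := by
  induction n generalizing c with
  | zero => simp
  | succ n ih =>
    have h := ih (c + 1)
    rw [qFact_succ] at h
    rw [show n + (c + 1) = n + 1 + c by ring] at h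
    have h1 : 1 - q ^ n * (q ^ (n + 1 + c))⁻¹ = -(1 - q ^ (c + 1)) * (q ^ (c + 1))⁻¹ := by
      field_simp; ring
    have h2 : q ^ n * (q ^ ((n + 1 + c) * (n + 1)))⁻¹ =
        (q ^ ((n + 1 + c) * n))⁻¹ * (q ^ (c + 1))⁻¹ := by
      field_simp; ring
    rw [prod_range_succ, h1, pow_choose_two_succ]
    linear_combination -(q ^ (c + 1))⁻¹ * h -
      (-1) ^ (n + 1) * q ^ n.choose 2 * qFact q (n + 1 + c) * h2

lemma prod_one_sub_div_eq_zero {q : ℝ} (hq0 : 0 < q) {n a : ℕ} (h : a < n) :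
    ∏ i ∈ range n, (1 - q ^ i * (q ^ a)⁻¹) = 0 :=
  prod_eq_zero (mem_range.2 h) (by rw [mul_inv_cancel₀ (pow_pos hq0 a).ne', sub_self])

section GeneratingFunctions

lemma HasSum.cauchy_product {f g : ℕ → ℂ} {a b : ℂ} (hf : HasSum f a) (hg : HasSum g b) :
    HasSum (fun n => ∑ i ∈ range (n + 1), f i * g (n - i)) (a * b) := by
  have hs := (summable_norm_sum_mul_range_of_summable_norm hf.summable.norm
    hg.summable.norm).of_norm
  have h := tsum_mul_tsum_eq_tsum_sum_range_of_summable_norm hf.summable.norm hg.summable.norm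
  rw [hf.tsum_eq, hg.tsum_eq] at h
  rw [h]
  exact hs.hasSum

/-- The homogeneous `q`-binomial series `∑ [n+k, k] z^n = 1 / (z; q)_{k+1}`. -/
lemma hasSum_gaussBinom {q : ℂ} (hq : ‖q‖ ≤ 1) {z : ℂ} (hz : ‖z‖ < 1) (k : ℕ) :
    HasSum (fun n => gaussBinom q (n + k) k * z ^ n) (qPoch z q (k + 1))⁻¹ := by
  induction k with
  | zero => simpa [qPoch] using hasSum_geometric_of_norm_lt_one hz
  | succ k ih =>
    have hz' : ‖q ^ (k + 1) * z‖ < 1 := by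
      rw [norm_mul, norm_pow]
      exact (mul_le_of_le_one_left (norm_nonneg z) (pow_le_one₀ (norm_nonneg q) hq)).trans_lt hz
    have h := ih.cauchy_product (hasSum_geometric_of_norm_lt_one hz')
    rw [← mul_inv, qPoch, ← prod_range_succ, ← qPoch] at h
    convert h using 2 with n
    induction n with
    | zero => simp
    | succ n ihn =>
      rw [sum_range_succ, show n + 1 + (k + 1) = (n + 1 + k) + 1 by ring, gaussBinom_succ_succ,
        add_mul, Nat.sub_self, pow_zero, mul_one, add_comm]
      congr 1
      rw [show n + 1 + k = n + (k + 1) by ring, pow_succ]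
      calc _ = (gaussBinom q (n + (k + 1)) (k + 1) * z ^ n) * (q ^ (k + 1) * z) := by ring
        _ = _ := by
          rw [ihn, sum_mul]
          refine sum_congr rfl fun i hi => ?_
          have : n + 1 - i = (n - i) + 1 := by have := mem_range.1 hi; omega
          rw [this, pow_succ]; ring

/-- The polynomial `(u z; q)_k` as a power series. -/
lemma hasSum_qPoch (q u z : ℂ) (k : ℕ) :
    HasSum (fun j => (-1) ^ j * q ^ j.choose 2 * gaussBinom q k j * (u * z) ^ j)
      (qPoch (u * z) q k) := by
  rw [qPoch, prod_one_sub_eq_sum_gaussBinom]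
  refine hasSum_sum_of_ne_finset_zero fun j hj => ?_
  rw [gaussBinom_eq_zero_of_lt q (by simpa [Nat.lt_succ_iff] using hj)]
  ring

end GeneratingFunctions

/-! ### Averages of products of determinants -/

lemma hasSum_mul_prod {ι κ : Type*} {f : ι → ℝ} {g : κ → ℝ} {a b : ℝ} (hf : HasSum f a)
    (hg : HasSum g b) : HasSum (fun p : ι × κ => f p.1 * g p.2) (a * b) := by
  have h : Summable fun p : ι × κ => f p.1 * g p.2 :=
    summable_mul_of_summable_norm hf.summable.norm hg.summable.norm
  exact hf.mul hg h

/-- The sum over `ι^n` of a product of functions of one variable each is the product of the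
sums. -/
lemma hasSum_pi_prod {ι : Type*} {n : ℕ} {f : Fin n → ι → ℝ} {a : Fin n → ℝ}
    (hf : ∀ i, HasSum (f i) (a i)) :
    HasSum (fun m : Fin n → ι => ∏ i, f i (m i)) (∏ i, a i) := by
  induction n with
  | zero => simp
  | succ n ih =>
    have h := ih (fun i => hf i.succ)
    have h0 := hasSum_mul_prod (hf 0) h
    rw [Fin.prod_univ_succ, ← (Fin.consEquiv fun _ => ι).hasSum_iff]
    simpa [Function.comp_def, Fin.prod_univ_succ] using h0

lemma sum_perm_apply_zero (n : ℕ) (F : Fin (n + 1) → ℝ) :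
    ((n + 1 : ℕ) : ℝ) * ∑ σ : Equiv.Perm (Fin (n + 1)), F (σ 0) =
      ((n + 1).factorial : ℝ) * ∑ j, F j := by
  -- the sum of `F (σ i)` over `σ` does not depend on `i`, so it may be averaged over `i`
  have h : ∀ i : Fin (n + 1), ∑ σ : Equiv.Perm (Fin (n + 1)), F (σ i) =
      ∑ σ : Equiv.Perm (Fin (n + 1)), F (σ 0) := fun i =>
    Fintype.sum_equiv (Equiv.mulRight (Equiv.swap 0 i)) _ _ fun σ => by simp
  calc _ = ∑ i : Fin (n + 1), ∑ σ : Equiv.Perm (Fin (n + 1)), F (σ i) := by simp [h]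
    _ = ∑ σ : Equiv.Perm (Fin (n + 1)), ∑ i, F (σ i) := sum_comm
    _ = ∑ σ : Equiv.Perm (Fin (n + 1)), ∑ j, F j :=
      sum_congr rfl fun σ _ => Equiv.sum_comp σ F
    _ = _ := by simp [Fintype.card_perm]

/-- Andréief's identity for orthogonal functions `φ_j` with one extra factor `G` in the first
variable: only the diagonal terms `σ = τ` of the product of the two expanded determinants
survive. -/
lemma hasSum_mul_det_sq {ι : Type*} {n : ℕ} {W G : ι → ℝ} {φ : Fin (n + 1) → ι → ℝ}
    {h : Fin (n + 1) → ℝ} {B : Fin (n + 1) → Fin (n + 1) → ℝ}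
    (hφ : ∀ i j, HasSum (fun m => φ i m * φ j m * W m) (if i = j then h i else 0))
    (hG : ∀ i j, HasSum (fun m => G m * (φ i m * φ j m * W m)) (B i j)) (hh : ∀ i, h i ≠ 0) :
    HasSum (fun m : Fin (n + 1) → ι =>
        G (m 0) * ((∏ i, W (m i)) * (Matrix.of fun i j => φ j (m i)).det ^ 2))
      ((∏ i, h i) * ∑ σ : Equiv.Perm (Fin (n + 1)), B (σ 0) (σ 0) / h (σ 0)) := by
  have hterm : ∀ σ τ : Equiv.Perm (Fin (n + 1)),
      HasSum (fun m : Fin (n + 1) → ι =>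
        ((Equiv.Perm.sign σ : ℤ) : ℝ) * ((Equiv.Perm.sign τ : ℤ) : ℝ) *
          (G (m 0) * ∏ i, (φ (σ i) (m i) * φ (τ i) (m i) * W (m i))))
        (if σ = τ then (∏ i, h i) * (B (σ 0) (σ 0) / h (σ 0)) else 0) := by
    intro σ τ
    have hs : HasSum (fun m : Fin (n + 1) → ι =>
          G (m 0) * ∏ i, (φ (σ i) (m i) * φ (τ i) (m i) * W (m i)))
        (B (σ 0) (τ 0) * ∏ i : Fin n, if σ i.succ = τ i.succ then h (σ i.succ) else 0) := by
      have h1 := hasSum_pi_prod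
        (f := Fin.cons (fun m => G m * (φ (σ 0) m * φ (τ 0) m * W m))
          (fun i : Fin n => fun m => φ (σ i.succ) m * φ (τ i.succ) m * W m))
        (a := Fin.cons (B (σ 0) (τ 0))
          (fun i : Fin n => if σ i.succ = τ i.succ then h (σ i.succ) else 0))
        (fun i => by
          refine Fin.cases ?_ (fun i => ?_) i
          · simpa using hG (σ 0) (τ 0)
          · simpa using hφ (σ i.succ) (τ i.succ))
      simpa [Fin.prod_univ_succ, mul_assoc] using h1
    have h2 := hs.mul_left (((Equiv.Perm.sign σ : ℤ) : ℝ) * ((Equiv.Perm.sign τ : ℤ) : ℝ))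
    refine (congrArg (HasSum _ · _) ?_).mp h2
    split_ifs with hστ
    · subst hστ
      have hsq : ((Equiv.Perm.sign σ : ℤ) : ℝ) * ((Equiv.Perm.sign σ : ℤ) : ℝ) = 1 := by
        rw [← Int.cast_mul, ← Units.val_mul, Int.units_mul_self]; simp
      rw [hsq, one_mul, ← Equiv.prod_comp σ h, Fin.prod_univ_succ]
      have := hh (σ 0)
      simp only [if_true]
      field_simp
    · -- permutations that agree away from `0` are equal
      obtain ⟨i, hi⟩ : ∃ i : Fin n, σ i.succ ≠ τ i.succ := by
        by_contra! hall
        refine hστ (Equiv.ext fun i => ?_)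
        by_contra hne
        obtain ⟨j, hj⟩ := τ.surjective (σ i)
        have hji : j ≠ i := fun e => hne (by rw [← hj, e])
        by_cases h0 : j = 0
        · subst h0
          obtain ⟨l, rfl⟩ := Fin.exists_succ_eq.2 hji.symm
          exact hne (hall l)
        · obtain ⟨l, rfl⟩ := Fin.exists_succ_eq.2 h0
          exact hji (σ.injective ((hall l).trans hj))
      rw [prod_eq_zero (mem_univ i) (if_neg hi), mul_zero, mul_zero]
  have hsum := hasSum_sum (s := univ) fun σ _ => hasSum_sum (s := univ) fun τ _ => hterm σ τ
  convert hsum using 1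
  · funext m
    rw [← Matrix.det_transpose, Matrix.det_apply', sq, sum_mul_sum, mul_sum, mul_sum]
    refine sum_congr rfl fun σ _ => ?_
    rw [mul_sum, mul_sum]
    refine sum_congr rfl fun τ _ => ?_
    simp only [Matrix.transpose_apply, Matrix.of_apply, prod_mul_distrib]
    ring
  · simp [mul_sum]

/-! ### The Stieltjes–Wigert polynomials and weight -/

/-- The coefficient of `x^j` in the `n`-th monic Stieltjes–Wigert polynomial. -/
noncomputable def swCoeff (q : ℝ) (n j : ℕ) : ℝ :=
  (-1) ^ n * (q ^ n ^ 2)⁻¹ * ((-1) ^ j * gaussBinom q n j * q ^ j ^ 2)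

/-- The `n`-th monic Stieltjes–Wigert polynomial. -/
noncomputable def swPoly (q : ℝ) (n : ℕ) : ℝ[X] :=
  ∑ j ∈ range (n + 1), C (swCoeff q n j) * X ^ j

lemma swPoly_eval (q : ℝ) (n : ℕ) (x : ℝ) :
    (swPoly q n).eval x = ∑ j ∈ range (n + 1), swCoeff q n j * x ^ j := by
  simp [swPoly, eval_finsetSum]

lemma swCoeff_self {q : ℝ} (hq0 : 0 < q) (n : ℕ) : swCoeff q n n = 1 := by
  have h : ((-1 : ℝ)) ^ n * (-1) ^ n = 1 := by rw [← mul_pow]; simp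
  rw [swCoeff, gaussBinom_self, mul_one]
  field_simp
  linear_combination h

lemma swPoly_natDegree_le (q : ℝ) (n : ℕ) : (swPoly q n).natDegree ≤ n :=
  natDegree_sum_le_of_forall_le _ _ fun _ hj =>
    (natDegree_C_mul_X_pow_le _ _).trans (Nat.lt_succ_iff.1 (mem_range.1 hj))

lemma swPoly_coeff_self {q : ℝ} (hq0 : 0 < q) (n : ℕ) : (swPoly q n).coeff n = 1 := by
  simp [swPoly, coeff_C_mul, coeff_X_pow, swCoeff_self hq0]

lemma swPoly_monic {q : ℝ} (hq0 : 0 < q) (n : ℕ) : (swPoly q n).Monic :=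
  monic_of_natDegree_le_of_coeff_eq_one n (swPoly_natDegree_le q n) (swPoly_coeff_self hq0 n)

lemma swPoly_natDegree {q : ℝ} (hq0 : 0 < q) (n : ℕ) : (swPoly q n).natDegree = n :=
  natDegree_eq_of_le_of_coeff_ne_zero (swPoly_natDegree_le q n)
    (by rw [swPoly_coeff_self hq0]; exact one_ne_zero)

/-- The pairing `⟨x^a, p_n⟩` of a monomial with the `n`-th Stieltjes–Wigert polynomial, for a
functional of total mass `M` (see `hasSum_pow_mul_swPoly`). -/
noncomputable def swPairing (q M : ℝ) (n a : ℕ) : ℝ :=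
  (-1) ^ n * (q ^ n ^ 2)⁻¹ * (M * (q ^ (a + 1).choose 2)⁻¹) *
    ∏ i ∈ range n, (1 - q ^ i * (q ^ a)⁻¹)

lemma swPairing_eq_zero {q : ℝ} (hq0 : 0 < q) (M : ℝ) {n a : ℕ} (h : a < n) :
    swPairing q M n a = 0 := by
  rw [swPairing, prod_one_sub_div_eq_zero hq0 h, mul_zero]

lemma swPairing_self {q : ℝ} (hq0 : 0 < q) (M : ℝ) (n : ℕ) :
    swPairing q M n n = M * qFact q n * (q ^ (2 * n ^ 2 + n))⁻¹ := by
  have h := prod_one_sub_div_mul_qFact hq0 n 0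
  have hs : ((-1 : ℝ)) ^ n * (-1) ^ n = 1 := by rw [← mul_pow]; simp
  simp only [add_zero, qFact, range_zero, prod_empty, mul_one] at h
  rw [swPairing, h, pow_choose_two_succ, qFact]
  field_simp
  linear_combination M * (∏ i ∈ range n, (1 - q ^ (i + 1))) * q ^ (2 * n ^ 2 + n) * hs

lemma swPairing_self_pos {q M : ℝ} (hq0 : 0 < q) (hq1 : q < 1) (hM : 0 < M) (n : ℕ) :
    0 < swPairing q M n n := by
  rw [swPairing_self hq0]
  have := qFact_pos hq0 hq1 n
  positivity

lemma swPairing_add {q : ℝ} (hq0 : 0 < q) (hq1 : q < 1) (M : ℝ) (n b : ℕ) :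
    swPairing q M n (n + b) = swPairing q M n n *
      (gaussBinom q (n + b) n * (q ^ (b + 1).choose 2)⁻¹ * (q ^ (2 * n * b))⁻¹) := by
  have h := prod_one_sub_div_mul_qFact hq0 n b
  have hs : ((-1 : ℝ)) ^ n * (-1) ^ n = 1 := by rw [← mul_pow]; simp
  have hb := (qFact_pos hq0 hq1 b).ne'
  have hP := gaussBinom_mul_qFact_mul_qFact q n b
  have h2 : ∏ i ∈ range n, (1 - q ^ i * (q ^ (n + b))⁻¹) = (-1) ^ n * q ^ n.choose 2 *
      (q ^ ((n + b) * n))⁻¹ * (gaussBinom q (n + b) n * qFact q n) :=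
    mul_right_cancel₀ hb (by rw [h, ← hP]; ring)
  rw [swPairing_self hq0, swPairing, h2, pow_choose_two_succ, pow_choose_two_succ,
    pow_choose_two_add]
  field_simp
  ring_nf
  simp [mul_comm n 2, pow_mul]

section Pairing

variable {q M : ℝ} {W : ℤ → ℝ}

/-- For a weight on the lattice `q^ℤ` with the Stieltjes–Wigert moments `M q^(-a(a+1)/2)`, the
pairing with a power is evaluated by the finite `q`-binomial theorem. -/
lemma hasSum_pow_mul_swPoly (hq0 : 0 < q)
    (hW : ∀ a : ℕ, HasSum (fun m : ℤ => (q ^ m) ^ a * W m) (M * (q ^ (a + 1).choose 2)⁻¹))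
    (n a : ℕ) :
    HasSum (fun m : ℤ => (q ^ m) ^ a * (swPoly q n).eval (q ^ m) * W m)
      (swPairing q M n a) := by
  have h := hasSum_sum (s := range (n + 1)) fun j _ => (hW (a + j)).mul_left (swCoeff q n j)
  refine (congrArg₂ (fun f a => HasSum f a) ?_ ?_).mpr h
  · funext m
    rw [swPoly_eval, mul_sum, sum_mul]
    exact sum_congr rfl fun j _ => by ring
  · rw [swPairing, prod_one_sub_eq_sum_gaussBinom, mul_sum]
    refine sum_congr rfl fun j _ => ?_
    have h1 : q ^ j ^ 2 * (q ^ (a + j + 1).choose 2)⁻¹ =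
        (q ^ (a + 1).choose 2)⁻¹ * q ^ j.choose 2 * (q ^ a)⁻¹ ^ j := by
      rw [add_right_comm, pow_choose_two_add, pow_sq_eq_pow_choose_two, inv_pow, ← pow_mul]
      field_simp
      ring
    rw [swCoeff]
    linear_combination -((-1) ^ n * (q ^ n ^ 2)⁻¹ * (-1) ^ j * gaussBinom q n j * M) * h1

/-- The pairing `⟨x^k p_i, p_j⟩`. -/
noncomputable def swPolyPairing (q M : ℝ) (k i j : ℕ) : ℝ :=
  ∑ l ∈ range (i + 1), swCoeff q i l * swPairing q M j (k + l)

lemma hasSum_pow_mul_swPoly_mul_swPoly (hq0 : 0 < q)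
    (hW : ∀ a : ℕ, HasSum (fun m : ℤ => (q ^ m) ^ a * W m) (M * (q ^ (a + 1).choose 2)⁻¹))
    (k i j : ℕ) :
    HasSum (fun m : ℤ => (q ^ m) ^ k *
        ((swPoly q i).eval (q ^ m) * (swPoly q j).eval (q ^ m) * W m))
      (swPolyPairing q M k i j) := by
  have h := hasSum_sum (s := range (i + 1)) fun l _ =>
    (hasSum_pow_mul_swPoly hq0 hW j (k + l)).mul_left (swCoeff q i l)
  refine (congrArg (fun f => HasSum f _) ?_).mpr h
  funext m
  rw [swPoly_eval q i, sum_mul, sum_mul, mul_sum]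
  exact sum_congr rfl fun l _ => by ring

lemma swPolyPairing_zero_of_lt (hq0 : 0 < q) {i j : ℕ} (h : i < j) :
    swPolyPairing q M 0 i j = 0 :=
  sum_eq_zero fun l hl => by
    rw [swPairing_eq_zero hq0 M (by have := mem_range.1 hl; omega), mul_zero]

lemma swPolyPairing_zero_self (hq0 : 0 < q) (n : ℕ) :
    swPolyPairing q M 0 n n = swPairing q M n n := by
  rw [swPolyPairing, sum_range_succ, sum_eq_zero, zero_add, zero_add, swCoeff_self hq0, one_mul]
  intro l hl
  rw [zero_add, swPairing_eq_zero hq0 M (mem_range.1 hl), mul_zero]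

/-- Orthogonality of the Stieltjes–Wigert polynomials. -/
lemma hasSum_swPoly_mul_swPoly (hq0 : 0 < q)
    (hW : ∀ a : ℕ, HasSum (fun m : ℤ => (q ^ m) ^ a * W m) (M * (q ^ (a + 1).choose 2)⁻¹))
    (i j : ℕ) :
    HasSum (fun m : ℤ => (swPoly q i).eval (q ^ m) * (swPoly q j).eval (q ^ m) * W m)
      (if i = j then swPairing q M i i else 0) := by
  rcases lt_trichotomy i j with h | rfl | h
  · simpa [swPolyPairing_zero_of_lt hq0 h, h.ne] using
      hasSum_pow_mul_swPoly_mul_swPoly hq0 hW 0 i j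
  · simpa [swPolyPairing_zero_self hq0] using hasSum_pow_mul_swPoly_mul_swPoly hq0 hW 0 i i
  · simpa [swPolyPairing_zero_of_lt hq0 h, h.ne', mul_comm ((swPoly q j).eval _)] using
      hasSum_pow_mul_swPoly_mul_swPoly hq0 hW 0 j i

/-- The diagonal pairings `⟨x^k p_n, p_n⟩ / ⟨p_n, p_n⟩`, times `q^(2kn)`, are the coefficients of
`q^(-k(k+1)/2) (q^(k+1) z; q)_k / (z; q)_{k+1}`, written as a Cauchy product. -/
lemma swPolyPairing_self_div (hq0 : 0 < q) (hq1 : q < 1) (hM : 0 < M) (k n : ℕ) :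
    q ^ (2 * k * n) * (swPolyPairing q M k n n / swPairing q M n n) =
      (q ^ (k + 1).choose 2)⁻¹ * ∑ i ∈ range (n + 1),
        ((-1) ^ i * q ^ i.choose 2 * gaussBinom q k i * (q ^ (k + 1)) ^ i) *
          gaussBinom q (n - i + k) k := by
  have hn := (swPairing_self_pos hq0 hq1 hM n).ne'
  rw [swPolyPairing, ← sum_range_reflect, sum_div, mul_sum, mul_sum]
  refine sum_congr rfl fun i hi => ?_
  have hin : i ≤ n := Nat.lt_succ_iff.1 (mem_range.1 hi)
  -- the term `i` on the right matches the coefficient of `x^(n-i)` in `p_n`; both sides vanish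
  -- for `k < i`
  rcases lt_or_ge k i with hki | hik
  · rw [gaussBinom_eq_zero_of_lt q hki, swPairing_eq_zero hq0 M (by omega)]
    simp
  obtain ⟨a, rfl⟩ := Nat.exists_eq_add_of_le hin
  obtain ⟨b, rfl⟩ := Nat.exists_eq_add_of_le hik
  have hs : ((-1 : ℝ)) ^ a * (-1) ^ a = 1 := by rw [← mul_pow]; simp
  have hg := gaussBinom_mul_gaussBinom_comm hq0 hq1 i a b
  rw [show i + a + 1 - 1 - i = a by omega, show i + b + a = (i + a) + b by ring,
    show i + a - i + (i + b) = i + a + b by omega, swPairing_add hq0 hq1, swCoeff,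
    show i + b + 1 = (b + 1) + i by ring, pow_choose_two_add q (b + 1) i,
    mul_comm (swPairing q M (i + a) (i + a)), ← mul_assoc (_ * _ : ℝ) _ (swPairing _ _ _ _),
    mul_div_cancel_right₀ _ hn]
  have hpow : q ^ (2 * (i + b) * (i + a)) * (q ^ (i + a) ^ 2)⁻¹ * q ^ a ^ 2 *
      (q ^ (2 * (i + a) * b))⁻¹ = (q ^ ((b + 1) * i))⁻¹ * (q ^ (b + 1 + i)) ^ i := by
    field_simp
    ring
  calc _ = ((-1) ^ a * (-1) ^ a) * (-1) ^ i * (q ^ (b + 1).choose 2)⁻¹ *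
        (gaussBinom q (i + a) a * gaussBinom q (i + a + b) (i + a)) *
        (q ^ (2 * (i + b) * (i + a)) * (q ^ (i + a) ^ 2)⁻¹ * q ^ a ^ 2 *
          (q ^ (2 * (i + a) * b))⁻¹) := by ring
    _ = _ := by
      rw [hs, hg, hpow]
      field_simp

end Pairing

section Weight

lemma qPochInfThree_pos {q : ℝ} (hq0 : 0 < q) (hq1 : q < 1) :
    0 < qPochInfThree (-q) (-1) q q := by
  have hlog : ∀ c : ℝ, Summable fun l : ℕ => Real.log (1 + c * q ^ l) := fun c =>
    Real.summable_log_one_add_of_summable ((summable_geometric_of_lt_one hq0.le hq1).mul_left c)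
  have h1 : ∀ l : ℕ, 0 < 1 + q * q ^ l := fun l => by positivity
  have h2 : ∀ l : ℕ, 0 < 1 + 1 * q ^ l := fun l => by positivity
  have h3 : ∀ l : ℕ, 0 < 1 + -q * q ^ l := fun l => by
    have : q * q ^ l < 1 := by
      rw [← pow_succ']; exact pow_lt_one₀ hq0.le hq1 l.succ_ne_zero
    linarith
  have heq : ∀ l : ℕ, (1 - -q * q ^ l) * (1 - -1 * q ^ l) * (1 - q * q ^ l) =
      (1 + q * q ^ l) * (1 + 1 * q ^ l) * (1 + -q * q ^ l) := fun l => by ring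
  simp only [qPochInfThree, heq]
  rw [← Real.rexp_tsum_eq_tprod fun l => mul_pos (mul_pos (h1 l) (h2 l)) (h3 l)]
  · exact Real.exp_pos _
  · refine (((hlog q).add (hlog 1)).add (hlog (-q))).congr fun l => ?_
    rw [Real.log_mul (mul_pos (h1 l) (h2 l)).ne' (h3 l).ne', Real.log_mul (h1 l).ne' (h2 l).ne']

/-- The weight `q^(m(m+1)/2)` on the exponents `m ∈ ℤ` of the lattice. -/
noncomputable def thetaWeight (q : ℝ) (m : ℤ) : ℝ := Real.exp (Real.log q * ((m : ℝ) * (m + 1) / 2))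

lemma thetaWeight_add_one {q : ℝ} (hq0 : 0 < q) (m : ℤ) :
    thetaWeight q (m + 1) = thetaWeight q m * q ^ m * q := by
  rw [mul_assoc, ← zpow_add_one₀ hq0.ne', ← Real.rpow_intCast, Real.rpow_def_of_pos hq0,
    thetaWeight, thetaWeight, ← Real.exp_add]
  congr 1
  push_cast
  ring

lemma summable_thetaWeight {q : ℝ} (hq0 : 0 < q) (hq1 : q < 1) : Summable (thetaWeight q) := by
  have h : Summable fun n : ℕ => thetaWeight q n := by
    refine (summable_geometric_of_lt_one hq0.le hq1).of_nonneg_of_le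
      (fun n => (Real.exp_pos _).le) fun n => ?_
    rw [← Real.rpow_natCast, Real.rpow_def_of_pos hq0, thetaWeight]
    refine Real.exp_le_exp.2 (mul_le_mul_of_nonpos_left ?_ (Real.log_neg hq0 hq1).le)
    rcases n.eq_zero_or_pos with rfl | hn
    · simp
    · have : (1 : ℝ) ≤ n := by exact_mod_cast hn
      push_cast
      nlinarith
  -- the exponent `m(m+1)/2` is invariant under `m ↦ -(m+1)`
  refine Summable.of_nat_of_neg_add_one h (h.congr fun n => ?_)
  rw [thetaWeight, thetaWeight]
  congr 1
  push_cast
  ring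

/-- The moments of the weight `q^(m(m+1)/2)`, up to the common factor `∑ q^(m(m+1)/2)`: the
recursion in `a` is the shift `m ↦ m + 1` of the summation index. -/
lemma hasSum_pow_mul_thetaWeight {q : ℝ} (hq0 : 0 < q) (hq1 : q < 1) (a : ℕ) :
    HasSum (fun m : ℤ => (q ^ m) ^ a * thetaWeight q m)
      ((∑' m, thetaWeight q m) * (q ^ (a + 1).choose 2)⁻¹) := by
  induction a with
  | zero => simpa using (summable_thetaWeight hq0 hq1).hasSum
  | succ a ih =>
    have h := ((Equiv.addRight (1 : ℤ)).hasSum_iff.2 ih).mul_left (q ^ (a + 1))⁻¹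
    rw [pow_choose_two_succ, mul_inv, ← mul_assoc, mul_comm _ (q ^ (a + 1))⁻¹]
    refine (congrArg (fun f => HasSum f _) (funext fun m => ?_)).mpr h
    rw [Function.comp_apply, Equiv.coe_addRight, thetaWeight_add_one hq0, zpow_add_one₀ hq0.ne']
    field_simp
    ring

/-- The mass `w(q^m; q) q^m` that the weight gives to the lattice point `q^m`. -/
noncomputable def swMass (q : ℝ) (m : ℤ) : ℝ := jacksonSWWeight q (q ^ m) * q ^ m

lemma swMass_eq {q : ℝ} (hq0 : 0 < q) (hq1 : q < 1) (m : ℤ) :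
    swMass q m = 1 / ((1 - q) * √q * qPochInfThree (-q) (-1) q q) * thetaWeight q m := by
  have hl := (Real.log_neg hq0 hq1).ne
  rw [swMass, jacksonSWWeight, mul_assoc, mul_assoc, thetaWeight]
  congr 1
  have hm : q ^ m = Real.exp (m * Real.log q) := by
    rw [← Real.log_zpow, Real.exp_log (zpow_pos hq0 m)]
  rw [hm, Real.rpow_def_of_pos (Real.exp_pos _), Real.log_exp, ← Real.exp_add, ← Real.exp_add]
  congr 1
  field_simp
  ring

lemma exists_hasSum_pow_mul_swMass {q : ℝ} (hq0 : 0 < q) (hq1 : q < 1) :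
    ∃ M : ℝ, 0 < M ∧ ∀ a : ℕ,
      HasSum (fun m : ℤ => (q ^ m) ^ a * swMass q m) (M * (q ^ (a + 1).choose 2)⁻¹) := by
  have hc : 0 < 1 / ((1 - q) * √q * qPochInfThree (-q) (-1) q q) := by
    have := qPochInfThree_pos hq0 hq1
    have := sub_pos.2 hq1
    positivity
  refine ⟨1 / ((1 - q) * √q * qPochInfThree (-q) (-1) q q) * ∑' m, thetaWeight q m,
    mul_pos hc ((summable_thetaWeight hq0 hq1).tsum_pos (fun m => (Real.exp_pos _).le) 0
      (Real.exp_pos _)), fun a => ?_⟩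
  rw [mul_assoc]
  refine ((hasSum_pow_mul_thetaWeight hq0 hq1 a).mul_left _).congr_fun fun m => ?_
  rw [swMass_eq hq0 hq1]
  ring

end Weight

/-! ### The ensemble and its generating function -/

section Ensemble

variable {q M : ℝ}

/-- At a lattice point the joint density is a product of one-variable masses times the square of
the determinant of the orthogonal polynomials, since these are monic. -/
lemma jacksonTerm_density (hq0 : 0 < q) {N : ℕ} (m : Fin N → ℤ) :
    jacksonTerm q (jacksonSWDensity q) m = (∏ i, swMass q (m i)) *
      (Matrix.of fun i j : Fin N => (swPoly q j).eval (q ^ m i)).det ^ 2 := by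
  rw [← Matrix.det_eval_matrixOfPolynomials_eq_det_vandermonde (fun i => q ^ m i)
    (fun j : Fin N => swPoly q j) (fun j => swPoly_natDegree hq0 j) (fun j => swPoly_monic hq0 j),
    Matrix.det_vandermonde, jacksonTerm, jacksonSWDensity]
  simp only [sq_abs, prod_pow, swMass, prod_mul_distrib]
  ring

/-- The Jackson sum of the joint density against `x_1^k`. -/
lemma hasSum_pow_mul_jacksonTerm (hq0 : 0 < q) (hq1 : q < 1) (hM : 0 < M)
    (hW : ∀ a : ℕ, HasSum (fun m : ℤ => (q ^ m) ^ a * swMass q m) (M * (q ^ (a + 1).choose 2)⁻¹))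
    (k n : ℕ) :
    HasSum (fun m : Fin (n + 1) → ℤ => (q ^ m 0) ^ k * jacksonTerm q (jacksonSWDensity q) m)
      ((∏ i : Fin (n + 1), swPairing q M i i) * ∑ σ : Equiv.Perm (Fin (n + 1)),
        swPolyPairing q M k (σ 0) (σ 0) / swPairing q M (σ 0) (σ 0)) := by
  have h := hasSum_mul_det_sq (W := swMass q) (G := fun m => (q ^ m) ^ k)
    (φ := fun (j : Fin (n + 1)) m => (swPoly q j).eval (q ^ m))
    (h := fun i => swPairing q M i i) (B := fun i j => swPolyPairing q M k i j)
    (fun i j => by simpa [Fin.ext_iff] using hasSum_swPoly_mul_swPoly hq0 hW (i : ℕ) j)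
    (fun i j => hasSum_pow_mul_swPoly_mul_swPoly hq0 hW k i j)
    (fun i => (swPairing_self_pos hq0 hq1 hM i).ne')
  simpa only [jacksonTerm_density hq0] using h

lemma hasSum_jacksonTerm (hq0 : 0 < q) (hq1 : q < 1) (hM : 0 < M)
    (hW : ∀ a : ℕ, HasSum (fun m : ℤ => (q ^ m) ^ a * swMass q m) (M * (q ^ (a + 1).choose 2)⁻¹))
    (n : ℕ) :
    HasSum (fun m : Fin (n + 1) → ℤ => jacksonTerm q (jacksonSWDensity q) m)
      ((∏ i : Fin (n + 1), swPairing q M i i) * ((n + 1).factorial : ℝ)) := by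
  have h := hasSum_pow_mul_jacksonTerm hq0 hq1 hM hW 0 n
  simp only [pow_zero, one_mul, swPolyPairing_zero_self hq0,
    div_self (swPairing_self_pos hq0 hq1 hM _).ne'] at h
  simpa [Fintype.card_perm] using h

lemma jacksonSWNorm_eq (hq0 : 0 < q) (hq1 : q < 1) (hM : 0 < M)
    (hW : ∀ a : ℕ, HasSum (fun m : ℤ => (q ^ m) ^ a * swMass q m) (M * (q ^ (a + 1).choose 2)⁻¹))
    (n : ℕ) :
    jacksonSWNorm q (n + 1) = (1 - q) ^ (n + 1) *
      ((∏ i : Fin (n + 1), swPairing q M i i) * ((n + 1).factorial : ℝ)) := by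
  rw [jacksonSWNorm, multiJacksonIntegral, (hasSum_jacksonTerm hq0 hq1 hM hW n).tsum_eq]

lemma jacksonSWNorm_pos (hq0 : 0 < q) (hq1 : q < 1) (n : ℕ) : 0 < jacksonSWNorm q (n + 1) := by
  obtain ⟨M, hM, hW⟩ := exists_hasSum_pow_mul_swMass hq0 hq1
  rw [jacksonSWNorm_eq hq0 hq1 hM hW]
  have h1 : 0 < 1 - q := sub_pos.2 hq1
  have h2 : 0 < ∏ i : Fin (n + 1), swPairing q M i i :=
    prod_pos fun i _ => swPairing_self_pos hq0 hq1 hM i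
  positivity

/-- The moment as a single sum over the lattice `(q^ℤ)^N`. -/
lemma jacksonSWLatticeMoment_eq_tsum (k n : ℕ)
    (hs : Summable fun m : Fin (n + 1) → ℤ =>
      (q ^ m 0) ^ k * jacksonTerm q (jacksonSWDensity q) m) :
    jacksonSWLatticeMoment q k n = ((n + 1 : ℕ) : ℝ) / jacksonSWNorm q (n + 1) *
      ((1 - q) ^ (n + 1) * ∑' m : Fin (n + 1) → ℤ,
        (q ^ m 0) ^ k * jacksonTerm q (jacksonSWDensity q) m) := by
  have hs' := (Fin.consEquiv fun _ : Fin (n + 1) => ℤ).summable_iff.2 hs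
  rw [← (Fin.consEquiv fun _ : Fin (n + 1) => ℤ).tsum_eq]
  have hp := Summable.tsum_prod hs'
  simp only [Function.comp_apply] at hp
  rw [hp, jacksonSWLatticeMoment, jacksonIntegral, pow_succ', mul_assoc, mul_left_comm]
  congr 1
  rw [← tsum_mul_left, ← tsum_mul_left]
  refine tsum_congr fun m => ?_
  have hin : ∀ y : Fin n → ℤ,
      (q ^ (Fin.consEquiv fun _ : Fin (n + 1) => ℤ) (m, y) 0) ^ k *
        jacksonTerm q (jacksonSWDensity q) ((Fin.consEquiv fun _ : Fin (n + 1) => ℤ) (m, y)) =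
      ((q ^ m) ^ k * q ^ m) * jacksonTerm q
        (fun y : Fin n → ℝ => jacksonSWDensity q (Fin.cons (q ^ m) y : Fin (n + 1) → ℝ)) y := by
    intro y
    have hc : (fun l => q ^ (Fin.cons m y : Fin (n + 1) → ℤ) l) =
        (Fin.cons (q ^ m) (fun l => q ^ y l) : Fin (n + 1) → ℝ) := by
      funext l
      refine Fin.cases ?_ (fun l => ?_) l <;> simp
    simp only [Fin.consEquiv_apply, jacksonTerm, hc, Fin.prod_univ_succ, Fin.cons_zero,
      Fin.cons_succ]
    ring
  simp only [hin, tsum_mul_left, jacksonSWSpectralDensity, multiJacksonIntegral]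
  ring

/-- The moments are partial sums of the normalised diagonal pairings. -/
lemma jacksonSWLatticeMoment_eq_sum (hq0 : 0 < q) (hq1 : q < 1) (hM : 0 < M)
    (hW : ∀ a : ℕ, HasSum (fun m : ℤ => (q ^ m) ^ a * swMass q m) (M * (q ^ (a + 1).choose 2)⁻¹))
    (k n : ℕ) :
    jacksonSWLatticeMoment q k n =
      ∑ j ∈ range (n + 1), swPolyPairing q M k j j / swPairing q M j j := by
  have h := hasSum_pow_mul_jacksonTerm hq0 hq1 hM hW k n
  have hperm := sum_perm_apply_zero n fun j =>
    swPolyPairing q M k j j / swPairing q M j j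
  rw [jacksonSWLatticeMoment_eq_tsum k n h.summable, h.tsum_eq, jacksonSWNorm_eq hq0 hq1 hM hW,
    ← Fin.sum_univ_eq_sum_range fun j => swPolyPairing q M k j j / swPairing q M j j]
  have h1 : (1 - q) ^ (n + 1) ≠ 0 := pow_ne_zero _ (sub_pos.2 hq1).ne'
  have h2 : ∏ i : Fin (n + 1), swPairing q M i i ≠ 0 :=
    prod_ne_zero_iff.2 fun i _ => (swPairing_self_pos hq0 hq1 hM i).ne'
  have h3 : ((n + 1).factorial : ℝ) ≠ 0 := by positivity
  rw [div_mul_eq_mul_div, div_eq_iff (mul_ne_zero h1 (mul_ne_zero h2 h3))]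
  linear_combination ((1 - q) ^ (n + 1) * ∏ i : Fin (n + 1), swPairing q M i i) * hperm

lemma jacksonSWMoment_eq (hq0 : 0 < q) (k n : ℕ) :
    jacksonSWMoment q k n = q ^ (-((k : ℝ) / 2)) * jacksonSWLatticeMoment q k n := by
  have hk : (q ^ (-(1 / 2) : ℝ)) ^ k = q ^ (-((k : ℝ) / 2)) := by
    rw [← Real.rpow_natCast, ← Real.rpow_mul hq0.le]
    congr 1
    ring
  simp only [jacksonSWMoment, jacksonSWLatticeMoment, jacksonIntegral, mul_pow, hk, mul_assoc,
    tsum_mul_left]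
  ring

end Ensemble

section GeneratingFunction

variable {q : ℝ}

lemma hasSum_jacksonSWLatticeMoment (hq0 : 0 < q) (hq1 : q < 1) (k : ℕ) {z : ℂ} (hz : ‖z‖ < 1) :
    HasSum (fun n : ℕ =>
        ((q : ℂ) ^ (2 * k) * z) ^ (n + 1) * ((jacksonSWLatticeMoment q k n : ℝ) : ℂ))
      ((q : ℂ) ^ (2 * k) * z * (((q : ℂ) ^ (k + 1).choose 2)⁻¹ *
        (qPoch ((q : ℂ) ^ (k + 1) * z) q k * (qPoch z q (k + 1))⁻¹) *
        (1 - (q : ℂ) ^ (2 * k) * z)⁻¹)) := by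
  obtain ⟨M, hM, hW⟩ := exists_hasSum_pow_mul_swMass hq0 hq1
  have hqn : ‖(q : ℂ)‖ ≤ 1 := by
    rw [Complex.norm_real, Real.norm_of_nonneg hq0.le]; exact hq1.le
  have hu : ‖(q : ℂ) ^ (2 * k) * z‖ < 1 := by
    rw [norm_mul, norm_pow]
    exact (mul_le_of_le_one_left (norm_nonneg z) (pow_le_one₀ (norm_nonneg _) hqn)).trans_lt hz
  -- the generating function of the summands of the moments
  have h1 := ((hasSum_qPoch q ((q : ℂ) ^ (k + 1)) z k).cauchy_product
    (hasSum_gaussBinom hqn hz k)).mul_left ((q : ℂ) ^ (k + 1).choose 2)⁻¹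
  have h2 : HasSum (fun n : ℕ => ((q : ℂ) ^ (2 * k) * z) ^ n *
      ((swPolyPairing q M k n n / swPairing q M n n : ℝ) : ℂ))
      (((q : ℂ) ^ (k + 1).choose 2)⁻¹ *
        (qPoch ((q : ℂ) ^ (k + 1) * z) q k * (qPoch z q (k + 1))⁻¹)) := by
    refine (congrArg (fun f => HasSum f _) (funext fun n => ?_)).mpr h1
    have h := congrArg (fun x : ℝ => (x : ℂ)) (swPolyPairing_self_div hq0 hq1 hM k n)
    simp only [Complex.ofReal_mul _ (_ / _ : ℝ), Complex.ofReal_mul (_⁻¹ : ℝ), Complex.ofReal_sum,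
      Complex.ofReal_inv, Complex.ofReal_pow] at h
    rw [mul_pow, ← pow_mul, mul_right_comm, h, mul_assoc, sum_mul]
    congr 1
    refine sum_congr rfl fun i hi => ?_
    have hin : z ^ n = z ^ i * z ^ (n - i) := by
      rw [← pow_add, Nat.add_sub_cancel' (Nat.lt_succ_iff.1 (mem_range.1 hi))]
    rw [gaussBinom_ofReal, gaussBinom_ofReal, hin]
    push_cast
    ring
  -- summation over `j ≤ n` is multiplication by a geometric series
  have h3 := (h2.cauchy_product (hasSum_geometric_of_norm_lt_one hu)).mul_left
    ((q : ℂ) ^ (2 * k) * z)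
  refine (congrArg (fun f => HasSum f _) (funext fun n => ?_)).mpr h3
  rw [jacksonSWLatticeMoment_eq_sum hq0 hq1 hM hW, Complex.ofReal_sum, pow_succ', mul_assoc,
    mul_sum]
  congr 1
  refine sum_congr rfl fun j hj => ?_
  rw [mul_right_comm, ← pow_add, Nat.add_sub_cancel' (Nat.lt_succ_iff.1 (mem_range.1 hj))]

lemma rpow_mul_jacksonSWGenFun (hq0 : 0 < q) (hq1 : q < 1) {k : ℕ} (hk : 1 ≤ k) {z : ℂ}
    (hz : ‖z‖ < 1) :
    ((q ^ ((k : ℝ) / 2) : ℝ) : ℂ) * jacksonSWGenFun q k z =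
      (q : ℂ) ^ (2 * k) * z * (((q : ℂ) ^ (k + 1).choose 2)⁻¹ *
        (qPoch ((q : ℂ) ^ (k + 1) * z) q k * (qPoch z q (k + 1))⁻¹) *
        (1 - (q : ℂ) ^ (2 * k) * z)⁻¹) := by
  have hu : 1 - (q : ℂ) ^ (2 * k) * z ≠ 0 := by
    intro h
    have h1 : ‖(q : ℂ) ^ (2 * k) * z‖ = 1 := by rw [← sub_eq_zero.1 h, norm_one]
    rw [norm_mul, norm_pow, Complex.norm_real, Real.norm_of_nonneg hq0.le] at h1
    have h2 : q ^ (2 * k) * ‖z‖ ≤ ‖z‖ :=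
      mul_le_of_le_one_left (norm_nonneg z) (pow_le_one₀ hq0.le hq1.le)
    linarith
  have hconst : q ^ ((k : ℝ) / 2) * q ^ (-((k : ℝ) ^ 2 - 2 * (k : ℝ)) / 2) =
      q ^ (2 * k) * (q ^ (k + 1).choose 2)⁻¹ := by
    rw [← Real.rpow_natCast q (2 * k), ← Real.rpow_natCast q ((k + 1).choose 2),
      ← Real.rpow_neg hq0.le, ← Real.rpow_add hq0,
      ← Real.rpow_add hq0, Nat.cast_choose_two]
    congr 1
    push_cast
    ring
  have hconst' := congrArg (fun x : ℝ => (x : ℂ)) hconst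
  simp only [Complex.ofReal_mul, Complex.ofReal_inv, Complex.ofReal_pow] at hconst'
  have h1 : qPoch ((q : ℂ) ^ (k + 1) * z) q k =
      qPoch ((q : ℂ) ^ (k + 1) * z) q (k - 1) * (1 - (q : ℂ) ^ (2 * k) * z) := by
    obtain ⟨k, rfl⟩ := Nat.exists_eq_add_of_le' hk
    rw [qPoch, qPoch, Nat.add_sub_cancel, prod_range_succ]
    ring
  have h2 : qPoch z q (k + 1) = (1 - z) * qPoch ((q : ℂ) * z) q k := by
    rw [qPoch, qPoch, prod_range_succ', pow_zero, one_mul, mul_comm]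
    congr 1
    exact prod_congr rfl fun i _ => by ring
  rw [jacksonSWGenFun, h1, h2, mul_inv]
  linear_combination
    z * (1 - z)⁻¹ * qPoch ((q : ℂ) ^ (k + 1) * z) q (k - 1) * (qPoch ((q : ℂ) * z) q k)⁻¹ *
      (hconst' - (q : ℂ) ^ (2 * k) * ((q : ℂ) ^ (k + 1).choose 2)⁻¹ * mul_inv_cancel₀ hu)

end GeneratingFunction

theorem proposition2p1 (q : ℝ) (hq0 : 0 < q) (hq1 : q < 1) (k : ℕ) (hk : 1 ≤ k) :
    -- the ensembles and their moments are well defined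
    (∀ n : ℕ,
      JacksonIntegrable q (jacksonSWDensity q (N := n + 1)) ∧
      0 < jacksonSWNorm q (n + 1) ∧
      JacksonIntegrable q (fun x : Fin (n + 1) → ℝ => x 0 ^ k * jacksonSWDensity q x)) ∧
    -- the generating function, the summation index being `N = n + 1`
    (∀ z : ℂ, ‖z‖ < 1 →
      HasSum (fun n : ℕ =>
          ((q : ℂ) ^ (2 * k) * z) ^ (n + 1) * ((jacksonSWMoment q k n : ℝ) : ℂ))
        (jacksonSWGenFun q k z)) ∧
    -- the same for the moments in the unscaled lattice variable
    (∀ z : ℂ, ‖z‖ < 1 →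
      HasSum (fun n : ℕ =>
          ((q : ℂ) ^ (2 * k) * z) ^ (n + 1) * ((jacksonSWLatticeMoment q k n : ℝ) : ℂ))
        (((q ^ ((k : ℝ) / 2) : ℝ) : ℂ) * jacksonSWGenFun q k z)) := by
  have hlat : ∀ z : ℂ, ‖z‖ < 1 →
      HasSum (fun n : ℕ =>
          ((q : ℂ) ^ (2 * k) * z) ^ (n + 1) * ((jacksonSWLatticeMoment q k n : ℝ) : ℂ))
        (((q ^ ((k : ℝ) / 2) : ℝ) : ℂ) * jacksonSWGenFun q k z) := fun z hz => by
    rw [rpow_mul_jacksonSWGenFun hq0 hq1 hk hz]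
    exact hasSum_jacksonSWLatticeMoment hq0 hq1 k hz
  refine ⟨fun n => ?_, fun z hz => ?_, hlat⟩
  · obtain ⟨M, hM, hW⟩ := exists_hasSum_pow_mul_swMass hq0 hq1
    refine ⟨(hasSum_jacksonTerm hq0 hq1 hM hW n).summable, jacksonSWNorm_pos hq0 hq1 n, ?_⟩
    refine (hasSum_pow_mul_jacksonTerm hq0 hq1 hM hW k n).summable.congr fun m => ?_
    rw [jacksonTerm, jacksonTerm, mul_assoc]
  · have h := (hlat z hz).mul_left ((q ^ (-((k : ℝ) / 2)) : ℝ) : ℂ)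
    rw [← mul_assoc, ← Complex.ofReal_mul, ← Real.rpow_add hq0, neg_add_cancel, Real.rpow_zero,
      Complex.ofReal_one, one_mul] at h
    refine (congrArg (fun f => HasSum f _) (funext fun n => ?_)).mpr h
    rw [jacksonSWMoment_eq hq0, Complex.ofReal_mul]
    ring
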